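/- **Setting.** For $x,y\in\mathbb R^2$ write $\det[x,y]^{\mathsf T}=x_1y_2-x_2y_1$. A simple piecewise linear curve $T\in\mathcal L_n[s,t;\mathbb R^2]$ has nodes $v_0=s,v_1,\dots,v_n=t$ and edges $e_j=(v_{j-1},v_j)$, $1\le j\le n$, that are nondegenerate, where consecutive edges meet exactly in their common node and all other pairs of edges are disjoint. It is identified with the $1$-current $e_1+\dots+e_n$; for $i\le j$, $T[v_i,v_j]=e_{i+1}+\dots+e_j$ has length $|T[v_i,v_j]|=\sum_{l=i+1}^{j}|e_l|$. For a $1$-current $T$ in $\mathbb R^2$ and $\lambda>0$ the flat norm is $$\mathbb F_\lambda(T)=\inf_{S}\{\mathbf M(T-\partial S)+\lambda\,\mathbf M(S)\},$$ where $S$ runs over the integral $2$-currents in $\mathbb R^2$ and $\mathbf M$ denotes mass (length, respectively area). Let $v_i$ be an interior node ($1\le i\le n-1$) of a curve $T$ with nodes $v_0,\dots,v_n$ and let $\delta>0$. A *positive $\delta$-perturbation* of $v_i\in T$ replaces $v_i$ by a point $\tilde v_i$, keeping all other nodes, such that $\|\tilde v_i-v_i\|<\delta$, $\det[\tilde v_i-v_i,\;v_i-v_{i-1}]^{\mathsf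 T}>0$, $\det[\tilde v_i-v_i,\;v_{i+1}-v_i]^{\mathsf T}>0$, and the closed segments $[v_{i-1},\tilde v_i]$ and $[\tilde v_i,v_{i+1}]$ meet $T$ at most in $v_{i-1}$ and in $v_{i+1}$, respectively. **Theorem.** Let $n\ge 3$, $T_0\in\mathcal L_n[s,t;\mathbb R^2]$ with nodes $v_0,\dots,v_n$, let $\lambda>0$ and $\delta>0$, and let $1\le k_0<k\le n-1$. Put $\tilde T_1^{k_0-1}=T_0$ and, for $i=k_0,\dots,k$, let $\tilde T_1^{i}$ be obtained from $\tilde T_1^{i-1}$ by a positive $\delta$-perturbation of its node $v_i$ (so that the preceding node of $\tilde T_1^{i-1}$ is the already perturbed $\tilde v_{i-1}$ when $i>k_0$). Then $$\mathbb F_\lambda(\tilde T_1^{k}-T_0)\le\frac{\lambda\delta}{2}\Big(\big|T_0[v_{k_0-1},v_{k+1}]\big|+\big|T_0[v_{k_0},v_k]\big|+(k-k_0)\,\delta\Big).$$ -/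

import Mathlib

open MeasureTheory
open scoped ENNReal NNReal ContinuousAlternatingMap

namespace FlatNorm

/-- Euclidean space `ℝᵖ` with its Euclidean norm. -/
abbrev E (p : ℕ) : Type := EuclideanSpace ℝ (Fin p)

/-- Smooth compactly supported differential `k`-forms on `ℝᵖ`. The norm of the value `ω x` is the
operator norm of an alternating map; over a Euclidean space this is the comass norm. -/
abbrev TestForm (p k : ℕ) : Type :=
  TestFunction (⊤ : TopologicalSpace.Opens (E p)) (E p [⋀^Fin k]→L[ℝ] ℝ) ⊤

/-- The exterior derivative on test forms, as a continuous linear map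
(see `extDerivTest_apply` for its agreement with `extDeriv`). -/
noncomputable def extDerivTest (p k : ℕ) : TestForm p k →L[ℝ] TestForm p (k + 1) :=
  (TestFunction.postcompCLM
    (ContinuousAlternatingMap.alternatizeUncurryFinCLM ℝ (E p) ℝ)) ∘L
    (TestFunction.fderivCLM ℝ ⊤ ⊤)

theorem extDerivTest_apply (p k : ℕ) (ω : TestForm p k) (x : E p) :
    extDerivTest p k ω x = extDeriv ω x := by
  simp [extDerivTest, extDeriv]

/-- `k`-dimensional currents in `ℝᵖ`: continuous linear functionals on test `k`-forms. -/
abbrev Current (p k : ℕ) : Type := TestForm p k →L[ℝ] ℝ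

/-- The boundary of a current, `(∂T)(ω) = T(dω)`. -/
noncomputable def boundary {p k : ℕ} (T : Current p (k + 1)) : Current p k :=
  T ∘L extDerivTest p k

/-- The mass (`k`-dimensional volume) of a current: the supremum of `|T(ω)|` over test forms of
comass at most one. -/
noncomputable def mass {p k : ℕ} (T : Current p k) : ℝ≥0∞ :=
  ⨆ (ω : TestForm p k) (_ : ∀ x, ‖ω x‖ ≤ 1), ENNReal.ofReal |T ω|

/-- The vectors `∂₁f(x), …, ∂ₖf(x)` of partial derivatives of `f : ℝᵏ → ℝᵖ`. -/
noncomputable def partials {p k : ℕ} (f : E k → E p) (x : E k) : Fin k → E p :=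
  fun i => fderiv ℝ f x (EuclideanSpace.single i 1)

/-- The `k`-dimensional Jacobian `|∂₁f(x) ∧ … ∧ ∂ₖf(x)|`. -/
noncomputable def jacobian {p k : ℕ} (f : E k → E p) (x : E k) : ℝ :=
  Real.sqrt (Matrix.gram ℝ (partials f x)).det

/-- Integer rectifiable `k`-currents with compact support in `ℝᵖ`: countable sums
`T = ∑ⱼ (fⱼ)_# (⟦ℝᵏ⟧ ⌞ θⱼ)` of push-forwards, under Lipschitz maps `fⱼ : ℝᵏ → ℝᵖ`, of `ℝᵏ` weighted
with measurable integer multiplicities `θⱼ`, of finite total `k`-dimensional volume and carried by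
one compact set. Lipschitz maps are differentiable almost everywhere. -/
def IsRectifiable {p k : ℕ} (T : Current p k) : Prop :=
  ∃ (f : ℕ → E k → E p) (θ : ℕ → E k → ℤ) (K : Set (E p)),
    IsCompact K ∧
    (∀ j, ∃ C : ℝ≥0, LipschitzWith C (f j)) ∧
    (∀ j, Measurable (θ j)) ∧
    (∀ j x, θ j x ≠ 0 → f j x ∈ K) ∧
    (∑' j, ∫⁻ x, ENNReal.ofReal (|(θ j x : ℝ)| * jacobian (f j) x)) < ∞ ∧
    ∀ ω : TestForm p k,
      HasSum (fun j => ∫ x, (θ j x : ℝ) * ω (f j x) (partials (f j) x)) (T ω)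

/-- Integral currents: rectifiable currents whose boundary (in positive dimension) is
rectifiable. -/
def IsIntegral {p : ℕ} : {k : ℕ} → Current p k → Prop
  | 0, T => IsRectifiable T
  | _ + 1, T => IsRectifiable T ∧ IsRectifiable (boundary T)

/-- The multiscale flat norm `F_λ(T) = inf_S (mass (T - ∂S) + λ mass S)`, where `S` ranges over
the integral `(k+1)`-currents. -/
noncomputable def flatNorm {p k : ℕ} (lam : ℝ) (T : Current p k) : ℝ≥0∞ :=
  ⨅ (S : Current p (k + 1)) (_ : IsIntegral S),
    mass (T - boundary S) + ENNReal.ofReal lam * mass S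

/-- Integration of a bounded continuous field of `1`-covectors along the segment from `a` to `b`. -/
noncomputable def segmentIntegral {p : ℕ} (a b : E p) :
    BoundedContinuousFunction (E p) (E p [⋀^Fin 1]→L[ℝ] ℝ) →L[ℝ] ℝ :=
  LinearMap.mkContinuous
    { toFun := fun ω => ∫ t in (0 : ℝ)..1, ω (AffineMap.lineMap a b t) (fun _ => b - a)
      map_add' := fun ω η => by
        have h (ξ : BoundedContinuousFunction (E p) (E p [⋀^Fin 1]→L[ℝ] ℝ)) :
            IntervalIntegrable
              (fun t : ℝ => ξ (AffineMap.lineMap a b t) (fun _ => b - a)) volume 0 1 := by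
          apply Continuous.intervalIntegrable
          have h1 : Continuous fun t : ℝ => ξ (AffineMap.lineMap a b t) :=
            ξ.continuous.comp AffineMap.lineMap_continuous
          exact (ContinuousAlternatingMap.apply ℝ (E p) ℝ (fun _ => b - a)).continuous.comp h1
        simpa using intervalIntegral.integral_add (h ω) (h η)
      map_smul' := fun c ω => by simp }
    ‖b - a‖
    (fun ω => by
      have h := intervalIntegral.norm_integral_le_of_norm_le_const (a := (0 : ℝ)) (b := 1)
        (f := fun t => ω (AffineMap.lineMap a b t) (fun _ => b - a)) (C := ‖b - a‖ * ‖ω‖)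
        (fun t _ => by
          calc ‖ω (AffineMap.lineMap a b t) (fun _ => b - a)‖
              ≤ ‖ω (AffineMap.lineMap a b t)‖ * ∏ _i : Fin 1, ‖b - a‖ :=
                ContinuousAlternatingMap.le_opNorm _ _
            _ ≤ ‖b - a‖ * ‖ω‖ := by
                simp only [Finset.univ_unique, Finset.prod_const, Finset.card_singleton, pow_one]
                rw [mul_comm]
                gcongr
                exact ω.norm_coe_le_norm _)
      simpa using h)

/-- The `1`-current of the oriented segment from `a` to `b` (see `edge_apply`). -/
noncomputable def edge {p : ℕ} (a b : E p) : Current p 1 :=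
  (segmentIntegral a b) ∘L (TestFunction.toBoundedContinuousFunctionCLM ℝ)

theorem edge_apply {p : ℕ} (a b : E p) (ω : TestForm p 1) :
    edge a b ω = ∫ t in (0 : ℝ)..1, ω (AffineMap.lineMap a b t) (fun _ => b - a) :=
  rfl

/-! Piecewise linear curves in the plane. A curve with `n` edges is given by its sequence of nodes
`v 0, …, v n`; the edges are `eⱼ = (v (j - 1), v j)`, `1 ≤ j ≤ n`, and the values `v j` with `j > n`
play no role. -/

/-- `v 0, …, v n` are the consecutive nodes of a simple piecewise linear curve with `n` edges from
`s` to `t`: the edges are nondegenerate, consecutive edges meet exactly in their common node, and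
other pairs of edges are disjoint. -/
structure IsSimplePWL (n : ℕ) (s t : E 2) (v : ℕ → E 2) : Prop where
  source : v 0 = s
  target : v n = t
  ne : ∀ j, j < n → v j ≠ v (j + 1)
  adjacent : ∀ j, j + 1 < n →
    segment ℝ (v j) (v (j + 1)) ∩ segment ℝ (v (j + 1)) (v (j + 2)) = {v (j + 1)}
  nonadjacent : ∀ i j, i + 1 < j → j < n →
    Disjoint (segment ℝ (v i) (v (i + 1))) (segment ℝ (v j) (v (j + 1)))

/-- The current `e₁ + … + eₙ` of the curve with nodes `v 0, …, v n`. -/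
noncomputable def pwlCurrent (n : ℕ) (v : ℕ → E 2) : Current 2 1 :=
  ∑ j ∈ Finset.range n, edge (v j) (v (j + 1))

/-- The point set of the curve with nodes `v 0, …, v n`. -/
def pwlSupport (n : ℕ) (v : ℕ → E 2) : Set (E 2) :=
  ⋃ j ∈ Finset.range n, segment ℝ (v j) (v (j + 1))

/-- The length `|T[v i, v j]| = |eᵢ₊₁| + … + |eⱼ|` of the part of the curve between the nodes `v i`
and `v j`. -/
noncomputable def subLength (v : ℕ → E 2) (i j : ℕ) : ℝ :=
  ∑ l ∈ Finset.Ico i j, dist (v l) (v (l + 1))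

/-- `det [x, y]ᵀ = x₁ y₂ - x₂ y₁`. -/
def det2 (x y : E 2) : ℝ := x 0 * y 1 - x 1 * y 0

/-- The positive cone at the interior node `v i`: the points `x` of the open `δ`-ball centred at
`v i` with `det [x - v i, eᵢ]ᵀ > 0` and `det [x - v i, eᵢ₊₁]ᵀ > 0`. -/
def positiveCone (δ : ℝ) (v : ℕ → E 2) (i : ℕ) : Set (E 2) :=
  {x | x ∈ Metric.ball (v i) δ ∧
    0 < det2 (x - v i) (v i - v (i - 1)) ∧ 0 < det2 (x - v i) (v (i + 1) - v i)}

/-- The allowed region at the interior node `v i`: the points `x` of the open `δ`-ball centred at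
`v i` such that the new edges `(v (i - 1), x)` and `(x, v (i + 1))` do not meet the curve, except
at the nodes `v (i - 1)` and `v (i + 1)`, respectively, from which they start. -/
def allowedRegion (n : ℕ) (δ : ℝ) (v : ℕ → E 2) (i : ℕ) : Set (E 2) :=
  {x | x ∈ Metric.ball (v i) δ ∧
    segment ℝ (v (i - 1)) x ∩ pwlSupport n v ⊆ {v (i - 1)} ∧
    segment ℝ x (v (i + 1)) ∩ pwlSupport n v ⊆ {v (i + 1)}}

/-- `v'` arises from the curve with nodes `v 0, …, v n` by a positive `δ`-perturbation of its
interior node `v i`: this node is moved to a point of the positive cone that lies in the allowed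
region, and all other nodes are kept. -/
def IsPositivePerturbation (n : ℕ) (δ : ℝ) (i : ℕ) (v v' : ℕ → E 2) : Prop :=
  1 ≤ i ∧ i < n ∧
    ∃ x ∈ positiveCone δ v i ∩ allowedRegion n δ v i, v' = Function.update v i x

end FlatNorm

namespace FlatNorm

/-! Moving a node `v i` to `x` changes the curve by the boundary of the two oriented triangles `(v
i, v (i-1), x)` and `(v i, x, v (i+1))`, whose common side cancels (`boundary_triangle`,
`exists_filling_update`). Each has mass at most half the product of its two sides at `v i`, one of
which has length at most `δ` (`mass_triangle_le`). A single move therefore costs at most `δ / 2`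
times the lengths of the two current edges at `v i`.

The fillings of successive moves add up to an integral current `S` whose boundary is the total
change, so the flat norm is at most `lam` times the mass of `S`. After the first move the preceding
node is already displaced, so the edge before `v i` is at most `δ` longer than the original one.
Summing over the moves gives the two lengths and the term `(k - k₀) * δ`
(`exists_filling_perturbations`). -/

/-! ### Mass and boundary of sums -/

theorem mass_zero {p k : ℕ} : mass (0 : Current p k) = 0 := by
  simp [mass]

theorem mass_add_le {p k : ℕ} (S T : Current p k) : mass (S + T) ≤ mass S + mass T := by
  refine iSup₂_le fun ω hω => ?_
  calc ENNReal.ofReal |(S + T) ω|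
      ≤ ENNReal.ofReal (|S ω| + |T ω|) := ENNReal.ofReal_le_ofReal (abs_add_le _ _)
    _ = ENNReal.ofReal |S ω| + ENNReal.ofReal |T ω| :=
        ENNReal.ofReal_add (abs_nonneg _) (abs_nonneg _)
    _ ≤ mass S + mass T :=
        add_le_add (le_iSup₂_of_le ω hω le_rfl) (le_iSup₂_of_le ω hω le_rfl)

theorem boundary_add {p k : ℕ} (S T : Current p (k + 1)) :
    boundary (S + T) = boundary S + boundary T :=
  ContinuousLinearMap.add_comp _ _ _

/-! ### Sums of integral currents -/

/-- Interleaving two sequences: `a 0, b 0, a 1, b 1, …`. -/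
def interleave {α : Type*} (a b : ℕ → α) (n : ℕ) : α :=
  if Even n then a (n / 2) else b (n / 2)

theorem interleave_even {α : Type*} (a b : ℕ → α) (n : ℕ) : interleave a b (2 * n) = a n := by
  simp [interleave]

theorem interleave_odd {α : Type*} (a b : ℕ → α) (n : ℕ) : interleave a b (2 * n + 1) = b n := by
  have : ¬ Even (2 * n + 1) := by simp
  rw [interleave, if_neg this]
  congr 1
  omega

/-- Two countable families of weighted Lipschitz pieces interleave into one; the volume series and
the defining sums split into even and odd terms. -/
theorem IsRectifiable.add {p k : ℕ} {S T : Current p k} (hS : IsRectifiable S)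
    (hT : IsRectifiable T) : IsRectifiable (S + T) := by
  obtain ⟨f, θ, K, hK, hf, hθ, hfK, hfin, hsum⟩ := hS
  obtain ⟨g, η, L, hL, hg, hη, hgL, hgfin, hgsum⟩ := hT
  have key {P : ℕ → Prop} (he : ∀ n, P (2 * n)) (ho : ∀ n, P (2 * n + 1)) (n : ℕ) : P n := by
    rcases Nat.even_or_odd' n with ⟨m, rfl | rfl⟩
    exacts [he m, ho m]
  refine ⟨interleave f g, interleave θ η, K ∪ L, hK.union hL, ?_, ?_, ?_, ?_, ?_⟩
  · refine key (fun n => ?_) (fun n => ?_)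
    · simpa only [interleave_even] using hf n
    · simpa only [interleave_odd] using hg n
  · refine key (fun n => ?_) (fun n => ?_)
    · simpa only [interleave_even] using hθ n
    · simpa only [interleave_odd] using hη n
  · refine key (fun n => ?_) (fun n => ?_)
    · simp only [interleave_even]
      exact fun x hx => Or.inl (hfK n x hx)
    · simp only [interleave_odd]
      exact fun x hx => Or.inr (hgL n x hx)
  · rw [← tsum_even_add_odd ENNReal.summable ENNReal.summable]
    simp only [interleave_even, interleave_odd]
    exact ENNReal.add_lt_top.2 ⟨hfin, hgfin⟩
  · intro ω
    refine HasSum.even_add_odd ?_ ?_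
    · simp only [interleave_even]
      exact hsum ω
    · simp only [interleave_odd]
      exact hgsum ω

theorem IsIntegral.add {p k : ℕ} {S T : Current p (k + 1)} (hS : IsIntegral S)
    (hT : IsIntegral T) : IsIntegral (S + T) :=
  ⟨hS.1.add hT.1, by rw [boundary_add]; exact hS.2.add hT.2⟩

/-! ### Affine pieces and edges -/

/-- A bounded piece of an affine parametrization is a rectifiable current. -/
theorem isRectifiable_of_affine {p k : ℕ} (c : E p) (A : E k →L[ℝ] E p) {s : Set (E k)}
    (hs : MeasurableSet s) (hb : Bornology.IsBounded s) {T : Current p k}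
    (hT : ∀ ω, T ω = ∫ x in s, ω (c + A x) (fun i => A (EuclideanSpace.single i 1))) :
    IsRectifiable T := by
  classical
  have hLip : LipschitzWith ‖A‖₊ (fun x => c + A x) := by
    simpa using (LipschitzWith.const c).add A.lipschitz
  have hpart (x : E k) : partials (fun x => c + A x) x =
      fun i => A (EuclideanSpace.single i 1) := by
    funext i
    simp [partials, fderiv_const_add]
  -- Only index `0` carries multiplicity, namely the indicator of `s`; all other pieces vanish.
  refine ⟨fun _ x => c + A x, fun j => if j = 0 then s.indicator 1 else 0,
    closure ((fun x => c + A x) '' s), (hLip.isBounded_image hb).isCompact_closure,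
    fun _ => ⟨_, hLip⟩, ?_, ?_, ?_, ?_⟩
  · intro j
    beta_reduce
    split_ifs
    · exact measurable_one.indicator hs
    · exact measurable_zero
  · intro j x hx
    refine subset_closure ⟨x, ?_, rfl⟩
    by_contra hxs
    apply hx
    beta_reduce
    split_ifs <;> simp [hxs]
  · rw [tsum_eq_single 0 (fun j hj => by simp [hj])]
    have : (fun x => ENNReal.ofReal (|(((if (0 : ℕ) = 0 then s.indicator 1 else 0 : E k → ℤ) x : ℤ)
        : ℝ)| * jacobian (fun x => c + A x) x)) =
        s.indicator (fun _ => ENNReal.ofReal (jacobian (fun x => c + A x) 0)) := by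
      funext x
      by_cases hx : x ∈ s <;> simp [hx, jacobian, hpart]
    rw [this, lintegral_indicator hs, setLIntegral_const]
    exact ENNReal.mul_lt_top ENNReal.ofReal_lt_top hb.measure_lt_top
  · intro ω
    have h0 := hasSum_single (f := fun j => ∫ x, ((if j = 0 then s.indicator 1 else 0 : E k → ℤ) x
        : ℝ) * ω (c + A x) (partials (fun x => c + A x) x)) 0 (fun j hj => by simp [hj])
    convert h0 using 1
    rw [hT, ← integral_indicator hs]
    congr 1
    funext x
    by_cases hx : x ∈ s <;> simp [hx, hpart]

theorem isRectifiable_edge {p : ℕ} (a b : E p) : IsRectifiable (edge a b) := by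
  have hm : MeasurableSet {x : E 1 | x 0 ∈ Set.Ioc (0 : ℝ) 1} :=
    measurableSet_Ioc.preimage (EuclideanSpace.proj (0 : Fin 1) : E 1 →L[ℝ] ℝ).continuous.measurable
  refine isRectifiable_of_affine a ((EuclideanSpace.proj (0 : Fin 1)).smulRight (b - a)) hm ?_ ?_
  · refine (Metric.isBounded_closedBall (x := (0 : E 1)) (r := 1)).subset fun x hx => ?_
    rw [mem_closedBall_zero_iff, EuclideanSpace.norm_eq]
    simp only [Finset.univ_unique, Finset.sum_singleton, Fin.default_eq_zero]
    rw [Real.sqrt_sq (norm_nonneg _), Real.norm_eq_abs, abs_of_pos hx.1]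
    exact hx.2
  · intro ω
    -- The identification of `E 1` with `ℝ` preserves volume and carries the half-open parameter set
    -- to `Ioc 0 1`, the domain of the interval integral.
    let e : E 1 ≃ᵐ ℝ :=
      (MeasurableEquiv.toLp 2 (Fin 1 → ℝ)).symm.trans (MeasurableEquiv.funUnique (Fin 1) ℝ)
    have he : MeasurePreserving e volume volume :=
      (EuclideanSpace.volume_preserving_symm_measurableEquiv_toLp (Fin 1)).trans
        (volume_preserving_funUnique (Fin 1) ℝ)
    have hx (x : E 1) : e x = x 0 := rfl
    rw [edge_apply, intervalIntegral.integral_of_le zero_le_one,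
      ← he.setIntegral_preimage_emb e.measurableEmbedding]
    refine setIntegral_congr_fun hm fun x _ => ?_
    have h1 (i : Fin 1) : (EuclideanSpace.single i 1 : E 1) 0 = 1 := by
      rw [Subsingleton.elim i 0]; simp
    simp only [hx, AffineMap.lineMap_apply, vsub_eq_sub, vadd_eq_add,
      ContinuousLinearMap.smulRight_apply, PiLp.proj_apply, h1, one_smul, add_comm]

theorem apply_const_sub {p : ℕ} (φ : E p [⋀^Fin 1]→L[ℝ] ℝ) (x y : E p) :
    φ (fun _ => x - y) = φ (fun _ => x) - φ (fun _ => y) :=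
  map_sub ((ContinuousAlternatingMap.ofSubsingleton ℝ (E p) ℝ (0 : Fin 1)).symm φ) x y

theorem edge_symm {p : ℕ} (a b : E p) : edge b a = -edge a b := by
  ext ω
  have h := intervalIntegral.integral_comp_sub_left
    (fun t => ω (AffineMap.lineMap a b t) (fun _ => b - a)) (a := 0) (b := 1) 1
  simp only [sub_self, sub_zero] at h
  rw [neg_apply, edge_apply, edge_apply, ← h, ← intervalIntegral.integral_neg]
  congr 1
  funext t
  rw [AffineMap.lineMap_apply_one_sub, apply_const_sub, apply_const_sub, neg_sub]

/-! ### Calculus on the standard triangle -/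

/-- The standard triangle in `ℝ²`, without its legs. -/
def stdTriangle : Set (ℝ × ℝ) :=
  {q | 0 < q.1 ∧ 0 < q.2 ∧ q.1 + q.2 ≤ 1}

theorem measurableSet_stdTriangle : MeasurableSet stdTriangle :=
  (measurableSet_lt measurable_const measurable_fst).inter
    ((measurableSet_lt measurable_const measurable_snd).inter
      (measurableSet_le (measurable_fst.add measurable_snd) measurable_const))

theorem stdTriangle_subset : stdTriangle ⊆ Set.Icc 0 1 ×ˢ Set.Icc 0 1 := by
  rintro ⟨x, y⟩ ⟨hx, hy, h⟩
  dsimp only at hx hy h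
  exact ⟨⟨hx.le, by linarith⟩, ⟨hy.le, by linarith⟩⟩

theorem integrableOn_stdTriangle {F : Type*} [NormedAddCommGroup F] {g : ℝ × ℝ → F}
    (hg : Continuous g) : IntegrableOn g stdTriangle :=
  (hg.continuousOn.integrableOn_compact (isCompact_Icc.prod isCompact_Icc)).mono_set
    stdTriangle_subset

theorem integral_stdTriangle {g : ℝ × ℝ → ℝ} (hg : Continuous g) :
    ∫ q in stdTriangle, g q = ∫ s in (0 : ℝ)..1, ∫ t in (0 : ℝ)..1 - s, g (s, t) := by
  rw [← integral_indicator measurableSet_stdTriangle, Measure.volume_eq_prod, integral_prod]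
  · rw [intervalIntegral.integral_of_le zero_le_one, ← integral_indicator measurableSet_Ioc]
    congr 1
    funext s
    by_cases hs : s ∈ Set.Ioc (0 : ℝ) 1
    · rw [Set.indicator_of_mem hs, intervalIntegral.integral_of_le (by linarith [hs.2]),
        ← integral_indicator measurableSet_Ioc]
      congr 1
      funext t
      -- Because the legs are left out, each slice is exactly the half-open interval of an interval
      -- integral, and no null sets have to be discarded.
      have : (s, t) ∈ stdTriangle ↔ t ∈ Set.Ioc (0 : ℝ) (1 - s) := by
        simp only [stdTriangle, Set.mem_ofPred_eq, Set.mem_Ioc, hs.1, true_and, le_sub_iff_add_le']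
      by_cases ht : t ∈ Set.Ioc (0 : ℝ) (1 - s)
      · rw [Set.indicator_of_mem ht, Set.indicator_of_mem (this.2 ht)]
      · rw [Set.indicator_of_notMem ht, Set.indicator_of_notMem (fun h => ht (this.1 h))]
    · rw [Set.indicator_of_notMem hs]
      have (t : ℝ) : stdTriangle.indicator g (s, t) = 0 := by
        refine Set.indicator_of_notMem (fun h => hs ⟨h.1, ?_⟩) _
        have := h.2.1; have := h.2.2; dsimp only at *; linarith
      simp [this]
  · rw [← Measure.volume_eq_prod]
    exact (integrableOn_stdTriangle hg).integrable_indicator measurableSet_stdTriangle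

theorem integral_stdTriangle_swap (g : ℝ × ℝ → ℝ) :
    ∫ q in stdTriangle, g q.swap = ∫ q in stdTriangle, g q := by
  have h := (Measure.measurePreserving_swap (μ := (volume : Measure ℝ))
    (ν := (volume : Measure ℝ))).setIntegral_preimage_emb
      MeasurableEquiv.prodComm.measurableEmbedding g stdTriangle
  rw [← Measure.volume_eq_prod] at h
  rw [← h]
  congr 2
  ext ⟨x, y⟩
  simp [stdTriangle, add_comm x y]
  tauto

theorem measureReal_stdTriangle : volume.real stdTriangle = 1 / 2 := by
  have h := integral_stdTriangle (g := fun _ => 1) continuous_const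
  rw [setIntegral_const, smul_eq_mul, mul_one] at h
  rw [h]
  simp only [intervalIntegral.integral_const, smul_eq_mul, mul_one, sub_zero]
  rw [intervalIntegral.integral_sub (by simp) (by simp), integral_id]
  norm_num

theorem volume_stdTriangle_lt_top : volume stdTriangle < ∞ :=
  (measure_mono stdTriangle_subset).trans_lt (isCompact_Icc.prod isCompact_Icc).measure_lt_top

/-- Integration of a partial derivative over the standard triangle. -/
theorem integral_stdTriangle_deriv_snd {f f' : ℝ × ℝ → ℝ} (hf : Continuous f)
    (hf' : Continuous f') (h : ∀ s t, HasDerivAt (fun t => f (s, t)) (f' (s, t)) t) :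
    ∫ q in stdTriangle, f' q =
      (∫ s in (0 : ℝ)..1, f (s, 1 - s)) - ∫ s in (0 : ℝ)..1, f (s, 0) := by
  rw [integral_stdTriangle hf', ← intervalIntegral.integral_sub]
  · congr 1
    funext s
    exact intervalIntegral.integral_eq_sub_of_hasDerivAt (fun t _ => h s t)
      (Continuous.intervalIntegrable (by fun_prop) _ _)
  all_goals exact Continuous.intervalIntegrable (by fun_prop) _ _

/-- Follows from the other variable, since the triangle is invariant under swapping coordinates. -/
theorem integral_stdTriangle_deriv_fst {f f' : ℝ × ℝ → ℝ} (hf : Continuous f)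
    (hf' : Continuous f') (h : ∀ s t, HasDerivAt (fun s => f (s, t)) (f' (s, t)) s) :
    ∫ q in stdTriangle, f' q =
      (∫ t in (0 : ℝ)..1, f (1 - t, t)) - ∫ t in (0 : ℝ)..1, f (0, t) := by
  rw [← integral_stdTriangle_swap]
  exact integral_stdTriangle_deriv_snd (f := fun q => f q.swap) (f' := fun q => f' q.swap)
    (by fun_prop) (by fun_prop) (fun s t => h t s)

/-! ### Triangle currents and Stokes' theorem -/

/-- The point with affine coordinates `q` with respect to the triangle `a b c`. -/
noncomputable def triangleMap {p : ℕ} (a b c : E p) (q : ℝ × ℝ) : E p :=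
  a + (q.1 • (b - a) + q.2 • (c - a))

theorem continuous_triangleMap {p : ℕ} (a b c : E p) : Continuous (triangleMap a b c) := by
  unfold triangleMap
  fun_prop

theorem continuous_form_triangleMap {p k : ℕ} {ω : E p → E p [⋀^Fin k]→L[ℝ] ℝ}
    (hω : Continuous ω) (a b c : E p) (m : Fin k → E p) :
    Continuous fun q => ω (triangleMap a b c q) m :=
  (ContinuousAlternatingMap.apply ℝ (E p) ℝ m).continuous.comp
    (hω.comp (continuous_triangleMap a b c))

/-- Integration of a bounded continuous field of `2`-covectors over the oriented triangle
`a b c`. -/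
noncomputable def triangleIntegral {p : ℕ} (a b c : E p) :
    BoundedContinuousFunction (E p) (E p [⋀^Fin 2]→L[ℝ] ℝ) →L[ℝ] ℝ :=
  LinearMap.mkContinuous
    { toFun := fun ω => ∫ q in stdTriangle, ω (triangleMap a b c q) ![b - a, c - a]
      map_add' := fun ω η =>
        integral_add
          (integrableOn_stdTriangle (continuous_form_triangleMap ω.continuous a b c _))
          (integrableOn_stdTriangle (continuous_form_triangleMap η.continuous a b c _))
      map_smul' := fun r ω => integral_const_mul r _ }
    ((∏ i, ‖![b - a, c - a] i‖) * volume.real stdTriangle)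
    (fun ω => by
      refine (norm_setIntegral_le_of_norm_le_const (C := ‖ω‖ * ∏ i, ‖![b - a, c - a] i‖)
        volume_stdTriangle_lt_top fun q _ => ?_).trans (le_of_eq (by ring))
      refine (ContinuousAlternatingMap.le_opNorm _ _).trans ?_
      gcongr
      exact ω.norm_coe_le_norm _)

/-- The `2`-current of the oriented triangle `a b c`. -/
noncomputable def triangle {p : ℕ} (a b c : E p) : Current p 2 :=
  (triangleIntegral a b c) ∘L (TestFunction.toBoundedContinuousFunctionCLM ℝ)

theorem triangle_apply {p : ℕ} (a b c : E p) (ω : TestForm p 2) :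
    triangle a b c ω = ∫ q in stdTriangle, ω (triangleMap a b c q) ![b - a, c - a] :=
  rfl

theorem isRectifiable_triangle {p : ℕ} (a b c : E p) : IsRectifiable (triangle a b c) := by
  let e : E 2 ≃ᵐ ℝ × ℝ :=
    (MeasurableEquiv.toLp 2 (Fin 2 → ℝ)).symm.trans MeasurableEquiv.finTwoArrow
  have he : MeasurePreserving e volume volume :=
    (EuclideanSpace.volume_preserving_symm_measurableEquiv_toLp (Fin 2)).trans
      (volume_preserving_finTwoArrow ℝ)
  have hx (x : E 2) : e x = (x 0, x 1) := rfl
  have hm : MeasurableSet (e ⁻¹' stdTriangle) := e.measurable measurableSet_stdTriangle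
  refine isRectifiable_of_affine a ((EuclideanSpace.proj (0 : Fin 2)).smulRight (b - a) +
    (EuclideanSpace.proj (1 : Fin 2)).smulRight (c - a)) hm ?_ ?_
  · refine (Metric.isBounded_closedBall (x := (0 : E 2)) (r := 2)).subset fun x hxs => ?_
    obtain ⟨⟨h0, h0'⟩, h1, h1'⟩ := stdTriangle_subset hxs
    rw [hx] at h0 h0' h1 h1'
    dsimp only at h0 h0' h1 h1'
    rw [mem_closedBall_zero_iff, EuclideanSpace.norm_eq, Fin.sum_univ_two]
    refine Real.sqrt_le_iff.2 ⟨by norm_num, ?_⟩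
    simp only [Real.norm_eq_abs, sq_abs]
    nlinarith
  · intro ω
    rw [triangle_apply, ← he.setIntegral_preimage_emb e.measurableEmbedding]
    refine setIntegral_congr_fun hm fun x _ => ?_
    have : (fun i => ((EuclideanSpace.proj (0 : Fin 2)).smulRight (b - a) +
        (EuclideanSpace.proj (1 : Fin 2)).smulRight (c - a) : E 2 →L[ℝ] E p)
          (EuclideanSpace.single i 1)) = ![b - a, c - a] := by
      funext i
      fin_cases i <;> simp
    rw [this]
    simp [hx, triangleMap]

theorem extDerivTest_one_apply {p : ℕ} (ω : TestForm p 1) (x u v : E p) :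
    extDerivTest p 1 ω x ![u, v] =
      fderiv ℝ ω x u (fun _ => v) - fderiv ℝ ω x v (fun _ => u) := by
  rw [extDerivTest_apply, extDeriv, ContinuousAlternatingMap.alternatizeUncurryFin_apply,
    Fin.sum_univ_two]
  have h0 : Fin.removeNth 0 ![u, v] = fun _ => v := by
    funext i; rw [Subsingleton.elim i 0]; rfl
  have h1 : Fin.removeNth 1 ![u, v] = fun _ => u := by
    funext i; rw [Subsingleton.elim i 0]; rfl
  simp [h0, h1, sub_eq_add_neg]

/-- Stokes' theorem for a triangle. -/
theorem boundary_triangle {p : ℕ} (a b c : E p) :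
    boundary (triangle a b c) = edge a b + edge b c + edge c a := by
  ext ω
  have hω : Continuous ω := ω.continuous
  have hdiff : Differentiable ℝ ω := ω.contDiff.differentiable (by simp)
  have hfd : Continuous (fderiv ℝ ω) := ω.contDiff.continuous_fderiv (by simp)
  have hcont (u m : E p) :
      Continuous fun q => fderiv ℝ ω (triangleMap a b c q) u (fun _ => m) :=
    (ContinuousAlternatingMap.apply ℝ (E p) ℝ (fun _ => m)).continuous.comp
      ((hfd.comp (continuous_triangleMap a b c)).clm_apply continuous_const)
  have hder (m u : E p) (γ : ℝ → E p) (r : ℝ) (hγ : HasDerivAt γ u r) :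
      HasDerivAt (fun r => ω (γ r) (fun _ => m)) (fderiv ℝ ω (γ r) u (fun _ => m)) r :=
    (ContinuousAlternatingMap.apply ℝ (E p) ℝ (fun _ : Fin 1 => m)).hasFDerivAt.comp_hasDerivAt r
      ((hdiff (γ r)).hasFDerivAt.comp_hasDerivAt r hγ)
  have hfst (s t : ℝ) : HasDerivAt (fun s => triangleMap a b c (s, t)) (b - a) s := by
    have := (((hasDerivAt_id s).smul_const (b - a)).add_const (t • (c - a))).const_add a
    simpa [triangleMap] using this
  have hsnd (s t : ℝ) : HasDerivAt (fun t => triangleMap a b c (s, t)) (c - a) t := by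
    have := (((hasDerivAt_id t).smul_const (c - a)).const_add (s • (b - a))).const_add a
    simpa [triangleMap] using this
  -- `h1` and `h2` integrate the two terms of `dω`, each along its direction of differentiation,
  -- leaving the hypotenuse `b c` minus one leg.
  have h1 := integral_stdTriangle_deriv_fst
    (continuous_form_triangleMap hω a b c (fun _ => c - a)) (hcont (b - a) (c - a))
    (fun s t => hder (c - a) (b - a) _ s (hfst s t))
  have h2 := integral_stdTriangle_deriv_snd
    (continuous_form_triangleMap hω a b c (fun _ => b - a)) (hcont (c - a) (b - a))
    (fun s t => hder (b - a) (c - a) _ t (hsnd s t))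
  have hbc (t : ℝ) : triangleMap a b c (1 - t, t) = AffineMap.lineMap b c t := by
    rw [triangleMap, AffineMap.lineMap_apply_module']
    module
  have hab (t : ℝ) : triangleMap a b c (t, 0) = AffineMap.lineMap a b t := by
    rw [triangleMap, AffineMap.lineMap_apply_module']
    module
  have hac (t : ℝ) : triangleMap a b c (0, t) = AffineMap.lineMap a c t := by
    rw [triangleMap, AffineMap.lineMap_apply_module']
    module
  -- `h2` runs along the hypotenuse from `c` to `b`; reversing the parameter aligns it with `h1`.
  have hflip : ∫ s in (0 : ℝ)..1, ω (triangleMap a b c (s, 1 - s)) (fun _ => b - a) =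
      ∫ t in (0 : ℝ)..1, ω (triangleMap a b c (1 - t, t)) (fun _ => b - a) := by
    have h := intervalIntegral.integral_comp_sub_left
      (fun t => ω (triangleMap a b c (t, 1 - t)) (fun _ => b - a)) (a := 0) (b := 1) 1
    simp only [sub_self, sub_zero, sub_sub_cancel] at h
    exact h.symm
  have hint (m : E p) : IntervalIntegrable
      (fun t : ℝ => ω (AffineMap.lineMap b c t) (fun _ => m)) volume 0 1 :=
    Continuous.intervalIntegrable ((ContinuousAlternatingMap.apply ℝ (E p) ℝ
      (fun _ => m)).continuous.comp (hω.comp AffineMap.lineMap_continuous)) _ _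
  -- The hypotenuse terms of `h1` and `h2` recombine because its tangent is `c - b = (c - a) - (b -
  -- a)`.
  have hbc' : edge b c ω = (∫ t in (0 : ℝ)..1, ω (AffineMap.lineMap b c t) (fun _ => c - a)) -
      ∫ t in (0 : ℝ)..1, ω (AffineMap.lineMap b c t) (fun _ => b - a) := by
    rw [edge_apply, ← intervalIntegral.integral_sub (hint _) (hint _)]
    congr 1
    funext t
    rw [← apply_const_sub, sub_sub_sub_cancel_right]
  rw [hflip] at h2
  simp only [hbc, hab, hac] at h1 h2
  have key : boundary (triangle a b c) ω =
      ∫ q in stdTriangle, (fderiv ℝ ω (triangleMap a b c q) (b - a) (fun _ => c - a) -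
        fderiv ℝ ω (triangleMap a b c q) (c - a) (fun _ => b - a)) := by
    change triangle a b c (extDerivTest p 1 ω) = _
    simp only [triangle_apply, extDerivTest_one_apply]
  rw [key, integral_sub (integrableOn_stdTriangle (hcont _ _))
    (integrableOn_stdTriangle (hcont _ _)), h1, h2, edge_symm a c]
  simp only [add_apply, neg_apply, hbc', edge_apply a b, edge_apply a c]
  ring

theorem isIntegral_triangle {p : ℕ} (a b c : E p) : IsIntegral (triangle a b c) := by
  refine ⟨isRectifiable_triangle a b c, ?_⟩
  rw [boundary_triangle]
  exact ((isRectifiable_edge a b).add (isRectifiable_edge b c)).add (isRectifiable_edge c a)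

/-! ### Mass and flat norm estimates -/

/-- Comass at most one bounds the integrand by the product of the sides at `a`, and the parameter
triangle has area `1 / 2`. -/
theorem mass_triangle_le {p : ℕ} (a b c : E p) :
    mass (triangle a b c) ≤ ENNReal.ofReal (dist a b * dist a c / 2) := by
  refine iSup₂_le fun ω hω => ENNReal.ofReal_le_ofReal ?_
  rw [triangle_apply, ← Real.norm_eq_abs]
  refine (norm_setIntegral_le_of_norm_le_const (C := dist a b * dist a c)
    volume_stdTriangle_lt_top fun q _ => ?_).trans (le_of_eq ?_)
  · refine ((ω _).le_opNorm _).trans ?_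
    rw [Fin.prod_univ_two]
    simp only [Matrix.cons_val_zero, Matrix.cons_val_one, ← dist_eq_norm]
    rw [dist_comm b a, dist_comm c a]
    exact mul_le_of_le_one_left (by positivity) (hω _)
  · rw [measureReal_stdTriangle]
    ring

theorem flatNorm_boundary_le {p k : ℕ} {lam : ℝ} {S : Current p (k + 1)} (hS : IsIntegral S) :
    flatNorm lam (boundary S) ≤ ENNReal.ofReal lam * mass S := by
  refine (iInf₂_le S hS).trans ?_
  rw [sub_self, mass_zero, zero_add]

/-! ### Perturbing nodes -/

theorem pwlCurrent_update_sub {n i : ℕ} (hi : 1 ≤ i) (hin : i < n) (v : ℕ → E 2) (x : E 2) :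
    pwlCurrent n (Function.update v i x) - pwlCurrent n v =
      edge (v (i - 1)) x + edge x (v (i + 1)) -
        (edge (v (i - 1)) (v i) + edge (v i) (v (i + 1))) := by
  obtain ⟨m, rfl⟩ : ∃ m, i = m + 1 := ⟨i - 1, by omega⟩
  rw [pwlCurrent, pwlCurrent, ← Finset.sum_sub_distrib, Finset.sum_eq_add_of_mem m (m + 1)]
  · simp [Function.update_of_ne]
    abel
  · exact Finset.mem_range.2 (by omega)
  · exact Finset.mem_range.2 hin
  · omega
  · intro j _ hj
    rw [Function.update_of_ne (by omega), Function.update_of_ne (by omega), sub_self]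

/-- Moving one interior node changes the curve by the boundary of two triangles. -/
theorem exists_filling_update {n i : ℕ} (hi : 1 ≤ i) (hin : i < n) (v : ℕ → E 2) {x : E 2} {δ : ℝ}
    (hx : dist (v i) x ≤ δ) :
    ∃ S : Current 2 2, IsIntegral S ∧
      boundary S = pwlCurrent n (Function.update v i x) - pwlCurrent n v ∧
      mass S ≤ ENNReal.ofReal (δ / 2 * (dist (v (i - 1)) (v i) + dist (v i) (v (i + 1)))) := by
  -- Both triangles have `v i` as first vertex, so the short side from `v i` to `x` enters both mass
  -- bounds.
  refine ⟨triangle (v i) (v (i - 1)) x + triangle (v i) x (v (i + 1)),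
    (isIntegral_triangle _ _ _).add (isIntegral_triangle _ _ _), ?_, ?_⟩
  · rw [boundary_add, boundary_triangle, boundary_triangle, pwlCurrent_update_sub hi hin,
      edge_symm (v i) x, edge_symm (v (i - 1)) (v i), edge_symm (v i) (v (i + 1))]
    abel
  · refine ((mass_add_le _ _).trans (add_le_add (mass_triangle_le _ _ _)
      (mass_triangle_le _ _ _))).trans ?_
    rw [← ENNReal.ofReal_add (by positivity) (by positivity)]
    refine ENNReal.ofReal_le_ofReal ?_
    rw [dist_comm (v (i - 1)) (v i)]
    nlinarith [mul_le_mul_of_nonneg_right hx (dist_nonneg (x := v i) (y := v (i - 1))),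
      mul_le_mul_of_nonneg_right hx (dist_nonneg (x := v i) (y := v (i + 1)))]

theorem IsPositivePerturbation.exists_update {n i : ℕ} {δ : ℝ} {v v' : ℕ → E 2}
    (h : IsPositivePerturbation n δ i v v') :
    1 ≤ i ∧ i < n ∧ ∃ x, dist (v i) x ≤ δ ∧ v' = Function.update v i x := by
  obtain ⟨hi, hin, x, hx, rfl⟩ := h
  exact ⟨hi, hin, x, (Metric.mem_ball'.1 hx.1.1).le, rfl⟩

theorem subLength_nonneg (v : ℕ → E 2) (i j : ℕ) : 0 ≤ subLength v i j :=
  Finset.sum_nonneg fun _ _ => dist_nonneg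

theorem subLength_succ (v : ℕ → E 2) {i j : ℕ} (h : i ≤ j) :
    subLength v i (j + 1) = subLength v i j + dist (v j) (v (j + 1)) :=
  Finset.sum_Ico_succ_top h _

theorem subLength_self (v : ℕ → E 2) (i : ℕ) : subLength v i i = 0 := by
  simp [subLength]

/-- Successive perturbations of the nodes `v k₀, …, v k` change the curve by the boundary of an
integral current of controlled area. -/
theorem exists_filling_perturbations {n : ℕ} {v : ℕ → E 2} {δ : ℝ} (hδ : 0 ≤ δ) {k₀ k : ℕ}
    {w : ℕ → ℕ → E 2} (hw₀ : w (k₀ - 1) = v)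
    (hw : ∀ i, k₀ ≤ i → i ≤ k → IsPositivePerturbation n δ i (w (i - 1)) (w i)) (hk : k₀ ≤ k) :
    (∀ l, k < l → w k l = v l) ∧ dist (v k) (w k k) ≤ δ ∧
    ∃ S : Current 2 2, IsIntegral S ∧ boundary S = pwlCurrent n (w k) - pwlCurrent n v ∧
      mass S ≤ ENNReal.ofReal (δ / 2 * (subLength v (k₀ - 1) (k + 1) + subLength v k₀ k
        + ((k : ℝ) - (k₀ : ℝ)) * δ)) := by
  -- The first two claims control the next move: its node and the following one are still original,
  -- and the preceding one is displaced by at most `δ`.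
  induction k, hk using Nat.le_induction with
  | base =>
    obtain ⟨hi, hin, x, hx, hwx⟩ := (hw k₀ le_rfl le_rfl).exists_update
    rw [hw₀] at hx hwx
    obtain ⟨S, hS, hb, hm⟩ := exists_filling_update hi hin v hx
    refine ⟨fun l hl => by rw [hwx, Function.update_of_ne (by omega)], by simpa [hwx] using hx,
      S, hS, by rw [hb, hwx], hm.trans_eq ?_⟩
    obtain ⟨m, rfl⟩ : ∃ m, k₀ = m + 1 := ⟨k₀ - 1, by omega⟩
    rw [Nat.add_sub_cancel, subLength_succ v (by omega), subLength_succ v le_rfl, subLength_self,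
      subLength_self]
    congr 1
    ring
  | succ k hk ih =>
    obtain ⟨hfix, hdist, S, hS, hb, hm⟩ := ih fun i hi hik => hw i hi (by omega)
    obtain ⟨hi, hin, x, hx, hwx⟩ := (hw (k + 1) (by omega) le_rfl).exists_update
    rw [Nat.add_sub_cancel] at hx hwx
    obtain ⟨S', hS', hb', hm'⟩ := exists_filling_update hi hin (w k) hx
    rw [Nat.add_sub_cancel, hfix (k + 1) (by omega), hfix (k + 1 + 1) (by omega)] at hm'
    rw [hfix (k + 1) (by omega)] at hx
    refine ⟨fun l hl => ?_, by simpa [hwx] using hx, S + S', hS.add hS', ?_, ?_⟩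
    · rw [hwx, Function.update_of_ne (by omega), hfix l (by omega)]
    · rw [boundary_add, hb, hb', hwx]
      abel
    · refine ((mass_add_le _ _).trans (add_le_add hm hm')).trans ?_
      have hkk : (0 : ℝ) ≤ (k : ℝ) - k₀ := sub_nonneg.2 (Nat.cast_le.2 hk)
      have h1 := subLength_nonneg v (k₀ - 1) (k + 1)
      have h2 := subLength_nonneg v k₀ k
      rw [← ENNReal.ofReal_add (by positivity) (by positivity)]
      refine ENNReal.ofReal_le_ofReal ?_
      -- The two lengths grow by exactly the two original edges at `v (k + 1)`.
      rw [subLength_succ v (show k₀ - 1 ≤ k + 1 by omega), subLength_succ v hk, ← mul_add]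
      refine mul_le_mul_of_nonneg_left ?_ (by positivity)
      -- The edge into `v (k + 1)` starts at the moved node `w k k`; the triangle inequality through
      -- `v k` costs one extra `δ`.
      have h3 := dist_triangle_left (w k k) (v (k + 1)) (v k)
      push_cast
      linarith

end FlatNorm

theorem mainTheorem2 (n : ℕ) (hn : 3 ≤ n) (s t : FlatNorm.E 2) (v : ℕ → FlatNorm.E 2)
    (hv : FlatNorm.IsSimplePWL n s t v) (lam δ : ℝ) (hlam : 0 < lam) (hδ : 0 < δ)
    (k₀ k : ℕ) (hk₀ : 1 ≤ k₀) (hk₀k : k₀ < k) (hk : k ≤ n - 1)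
    (w : ℕ → ℕ → FlatNorm.E 2) (hw₀ : w (k₀ - 1) = v)
    (hw : ∀ i, k₀ ≤ i → i ≤ k → FlatNorm.IsPositivePerturbation n δ i (w (i - 1)) (w i)) :
    FlatNorm.flatNorm lam (FlatNorm.pwlCurrent n (w k) - FlatNorm.pwlCurrent n v) ≤
      ENNReal.ofReal (lam * δ / 2 *
        (FlatNorm.subLength v (k₀ - 1) (k + 1) + FlatNorm.subLength v k₀ k
          + ((k : ℝ) - (k₀ : ℝ)) * δ)) := by
  obtain ⟨-, -, S, hS, hb, hm⟩ := FlatNorm.exists_filling_perturbations hδ.le hw₀ hw hk₀k.le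
  rw [← hb, mul_div_assoc, mul_assoc lam, ENNReal.ofReal_mul hlam.le]
  exact (FlatNorm.flatNorm_boundary_le hS).trans (mul_le_mul_right hm _)
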